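/- A Motzkin tree is a rooted plane tree in which every vertex has $0$, $1$ or $2$ children (an only child is neither left nor right). Let $M_k$ be the number of Motzkin trees with $k$ vertices ($M_0=0$), and let $N_{n,k}$ be the total number of vertices $v$, over all Motzkin trees with $n$ vertices, such that the subtree formed by $v$ and all its descendants has exactly $k$ vertices. Then: 1. For every $k\ge 0$, $$\sum_{n\ge 0} N_{n,k}\,x^n=\frac{M_k\,x^k}{\sqrt{1-2x-3x^2}}$$ as formal power series, where $\sqrt{1-2x-3x^2}$ is the formal power series with constant term $1$ whose square is $1-2x-3x^2$. 2. For every $k\ge 0$, the probability that a vertex chosen uniformly at random among all vertices of all Motzkin trees with $n$ vertices has a subtree with exactly $k$ vertices tends to $M_k\left(\tfrac13\right)^k$ as $n\to\infty$. 3. $\displaystyle\sum_{k\ge 0} M_k\left(\tfrac13\right)^k=1$, and the subtree size is a tight statistic: the laws, for $n\ge 1$, of the subtree size of a vertex chosen uniformly at random among all vertices of all Motzkin trees with $n$ vertices form a tight family of probability measures on $\mathbb N$. -/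

import Mathlib

open Filter Topology MeasureTheory PowerSeries

/-- A Motzkin (unary-binary) tree: a rooted plane tree in which every vertex has zero, one or two
children, the order of two children being relevant. -/
inductive MotzkinTree : Type
  | leaf : MotzkinTree
  | unary : MotzkinTree → MotzkinTree
  | binary : MotzkinTree → MotzkinTree → MotzkinTree

namespace MotzkinTree

/-- The vertices of a tree: the root, and the vertices of the trees hanging from the root. -/
inductive Vertex : MotzkinTree → Type
  | root (t : MotzkinTree) : Vertex t
  | child {t : MotzkinTree} : Vertex t → Vertex (unary t)
  | left {l r : MotzkinTree} : Vertex l → Vertex (binary l r)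
  | right {l r : MotzkinTree} : Vertex r → Vertex (binary l r)

/-- The number of vertices of a tree (see `card_vertex`). -/
def size : MotzkinTree → ℕ
  | leaf => 1
  | unary t => t.size + 1
  | binary l r => l.size + r.size + 1

/-- The subtree consisting of a vertex and all its descendants. -/
def Vertex.subtree : {t : MotzkinTree} → Vertex t → MotzkinTree
  | _, .root t => t
  | _, .child v => v.subtree
  | _, .left v => v.subtree
  | _, .right v => v.subtree

def vertexLeafEquiv : Vertex leaf ≃ Unit where
  toFun _ := ()
  invFun _ := .root leaf
  left_inv v := by cases v; rfl
  right_inv _ := rfl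

def vertexUnaryEquiv (t : MotzkinTree) : Vertex (unary t) ≃ Option (Vertex t) where
  toFun v := match v with
    | .root _ => none
    | .child w => some w
  invFun o := match o with
    | none => .root _
    | some w => .child w
  left_inv v := by cases v <;> rfl
  right_inv o := by cases o <;> rfl

def vertexBinaryEquiv (l r : MotzkinTree) :
    Vertex (binary l r) ≃ Option (Vertex l ⊕ Vertex r) where
  toFun v := match v with
    | .root _ => none
    | .left w => some (.inl w)
    | .right w => some (.inr w)
  invFun o := match o with
    | none => .root _
    | some (.inl w) => .left w
    | some (.inr w) => .right w
  left_inv v := by cases v <;> rfl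
  right_inv o := by rcases o with _ | _ | _ <;> rfl

instance finite_vertex (t : MotzkinTree) : Finite (Vertex t) := by
  induction t with
  | leaf => exact Finite.of_equiv _ vertexLeafEquiv.symm
  | unary t ih => exact Finite.of_equiv _ (vertexUnaryEquiv t).symm
  | binary l r ihl ihr => exact Finite.of_equiv _ (vertexBinaryEquiv l r).symm

theorem card_vertex (t : MotzkinTree) : Nat.card (Vertex t) = t.size := by
  induction t with
  | leaf => simp [Nat.card_congr vertexLeafEquiv, size]
  | unary t ih => rw [Nat.card_congr (vertexUnaryEquiv t), Finite.card_option, ih, size]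
  | binary l r ihl ihr =>
    rw [Nat.card_congr (vertexBinaryEquiv l r), Finite.card_option, Nat.card_sum, ihl, ihr, size]

theorem size_pos (t : MotzkinTree) : 0 < t.size := by
  cases t <;> simp [size]

theorem finite_size_le (n : ℕ) : {t : MotzkinTree | t.size ≤ n}.Finite := by
  induction n with
  | zero =>
    convert Set.finite_empty
    ext t
    have := t.size_pos
    simp only [Set.mem_ofPred_eq, Set.mem_empty_iff_false, iff_false]
    omega
  | succ n ih =>
    refine (((Set.finite_singleton leaf).union (ih.image unary)).union
      (Set.Finite.image2 binary ih ih)).subset ?_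
    intro t ht
    cases t with
    | leaf => simp
    | unary t =>
      left; right
      simp only [Set.mem_ofPred_eq, size] at ht
      exact ⟨t, by simp only [Set.mem_ofPred_eq]; omega, rfl⟩
    | binary l r =>
      right
      simp only [Set.mem_ofPred_eq, size] at ht
      exact ⟨l, by simp only [Set.mem_ofPred_eq]; omega,
        r, by simp only [Set.mem_ofPred_eq]; omega, rfl⟩

instance finite_size_eq (n : ℕ) : Finite {t : MotzkinTree // t.size = n} :=
  ((finite_size_le n).subset fun _ h => le_of_eq h).to_subtype

/-- The number of Motzkin trees with `k` vertices. -/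
noncomputable def numTrees (k : ℕ) : ℕ := Nat.card {t : MotzkinTree // t.size = k}

/-- A Motzkin tree together with one of its vertices. -/
structure Marked : Type where
  tree : MotzkinTree
  vertex : Vertex tree

instance : MeasurableSpace Marked := ⊤

/-- All vertices of all Motzkin trees with `n` vertices. -/
def verticesOfSize (n : ℕ) : Set Marked := {p | p.tree.size = n}

theorem finite_verticesOfSize (n : ℕ) : (verticesOfSize n).Finite := by
  have : Finite (Σ t : {t : MotzkinTree // t.size = n}, Vertex t.1) := inferInstance
  refine (Set.finite_range
    (fun p : (Σ t : {t : MotzkinTree // t.size = n}, Vertex t.1) =>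
      (⟨p.1.1, p.2⟩ : Marked))).subset ?_
  rintro ⟨t, v⟩ h
  exact ⟨⟨⟨t, h⟩, v⟩, rfl⟩

/-- The number of vertices, in all Motzkin trees with `n` vertices, whose subtree has `k`
vertices. -/
noncomputable def numVertices (n k : ℕ) : ℕ :=
  Set.ncard {p ∈ verticesOfSize n | p.vertex.subtree.size = k}

/-- The law of the size of the subtree of a vertex chosen uniformly at random among all vertices of
all Motzkin trees with `n` vertices. -/
noncomputable def subtreeSizeLaw (n : ℕ) : Measure ℕ :=
  (ProbabilityTheory.uniformOn (verticesOfSize n)).map fun p => p.vertex.subtree.size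

theorem verticesOfSize_nonempty (n : ℕ) : (verticesOfSize (n + 1)).Nonempty := by
  have h : ∃ t : MotzkinTree, t.size = n + 1 := by
    induction n with
    | zero => exact ⟨leaf, rfl⟩
    | succ n ih => obtain ⟨t, ht⟩ := ih; exact ⟨unary t, by rw [size, ht]⟩
  obtain ⟨t, ht⟩ := h
  exact ⟨⟨t, .root t⟩, ht⟩

instance isProbabilityMeasure_subtreeSizeLaw (n : ℕ) :
    IsProbabilityMeasure (subtreeSizeLaw (n + 1)) := by
  have : MeasurableSingletonClass Marked := ⟨fun _ => trivial⟩
  have := ProbabilityTheory.isProbabilityMeasure_uniformOn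
    (finite_verticesOfSize (n + 1)) (verticesOfSize_nonempty n)
  exact Measure.isProbabilityMeasure_map (Measurable.aemeasurable fun _ _ => trivial)

end MotzkinTree

/-! Let `M` be the series of trees, so `M = X (1 + M + M²)`. A marked tree is marked at the root or
in exactly one of the trees below the root. If the marked subtree must satisfy `Q`, the series `P`
of marked trees therefore obeys `P = M_Q + X (P + 2PM)`, i.e. `P = M_Q / s` with `s = 1 - X - 2XM`,
and the equation for `M` gives `s² = 1 - 2X - 3X²` (`weightSeries_marked`, `sqrtSeries_sq`). Taking
`Q` to be "size `k`" gives the first claim; taking `Q` always true counts all vertices.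

With `T n` the coefficients of `1/s`, the probability at size `n + k` is `2 M_k T n / (T (n+k+1) - T
(n+k))`. The differential equation of `1/s` gives a recurrence for `T`, whence `T (n+1) / T n → 3`
(`tendsto_ratio`) and the limit `M_k / 3^k`. The sum `y` of the limits satisfies `y = (1 + y +
y²)/3`, so `(y - 1)² = 0`. Since no mass is lost in the limit, the laws are tight. -/

/-! ### Generating functions of weighted types -/

/-- The generating function counting the elements of a type by a weight with values in `ℕ`. -/
noncomputable def weightSeries {α : Type*} (f : α → ℕ) : ℚ⟦X⟧ :=
  PowerSeries.mk fun n => (Nat.card {a // f a = n} : ℚ)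

namespace weightSeries

variable {α β : Type*}

theorem congr (e : α ≃ β) {f : α → ℕ} {g : β → ℕ} (h : ∀ a, f a = g (e a)) :
    weightSeries f = weightSeries g := by
  ext n
  simp only [weightSeries, coeff_mk]
  exact congrArg _ (Nat.card_congr (e.subtypeEquiv fun a => by rw [h a]))

theorem sum (f : α → ℕ) (g : β → ℕ) [∀ n, Finite {a // f a = n}] [∀ n, Finite {b // g b = n}] :
    weightSeries (Sum.elim f g) = weightSeries f + weightSeries g := by
  ext n
  simp only [weightSeries, coeff_mk, map_add]
  rw [Nat.card_congr (Equiv.subtypeSum (p := fun c => Sum.elim f g c = n))]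
  simp only [Sum.elim_inl, Sum.elim_inr]
  rw [Nat.card_sum, Nat.cast_add]

/-- Pairs of total weight `n`, sorted by the weights of their components. -/
def prodFiberEquiv (f : α → ℕ) (g : β → ℕ) (n : ℕ) :
    {p : α × β // f p.1 + g p.2 = n} ≃
      Σ q : Finset.HasAntidiagonal.antidiagonal n, {a // f a = q.1.1} × {b // g b = q.1.2} where
  toFun p := ⟨⟨(f p.1.1, g p.1.2), Finset.HasAntidiagonal.mem_antidiagonal.2 p.2⟩, ⟨p.1.1, rfl⟩, ⟨p.1.2, rfl⟩⟩
  invFun p := ⟨(p.2.1.1, p.2.2.1), by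
    rw [p.2.1.2, p.2.2.2]; exact Finset.HasAntidiagonal.mem_antidiagonal.1 p.1.2⟩
  left_inv _ := rfl
  right_inv := by
    rintro ⟨⟨⟨i, j⟩, h⟩, ⟨a, ha⟩, ⟨b, hb⟩⟩
    dsimp only at ha hb
    subst ha hb
    rfl

theorem prod (f : α → ℕ) (g : β → ℕ) [∀ n, Finite {a // f a = n}] [∀ n, Finite {b // g b = n}] :
    weightSeries (fun p : α × β => f p.1 + g p.2) = weightSeries f * weightSeries g := by
  ext n
  simp only [weightSeries, coeff_mk, coeff_mul]
  rw [Nat.card_congr (prodFiberEquiv f g n), Nat.card_sigma]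
  simp only [Nat.card_prod, Nat.cast_sum, Nat.cast_mul]
  exact Finset.sum_coe_sort (Finset.HasAntidiagonal.antidiagonal n)
    fun q => (Nat.card {a // f a = q.1} : ℚ) * Nat.card {b // g b = q.2}

theorem add_one (f : α → ℕ) : weightSeries (fun a => f a + 1) = X * weightSeries f := by
  ext n
  cases n with
  | zero => simp [weightSeries]
  | succ n => simp [weightSeries, coeff_succ_X_mul]

/-- No finiteness is needed: for infinite `α` both sides vanish, as `Nat.card` is then `0`. -/
theorem const (k : ℕ) : weightSeries (fun _ : α => k) = C (Nat.card α : ℚ) * X ^ k := by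
  ext n
  rw [coeff_C_mul, coeff_X_pow]
  simp only [weightSeries, coeff_mk]
  split_ifs with h
  · subst h
    simp
  · simp [Ne.symm h]

instance finite_sum_fiber (f : α → ℕ) (g : β → ℕ) [∀ n, Finite {a // f a = n}]
    [∀ n, Finite {b // g b = n}] (n : ℕ) : Finite {c // Sum.elim f g c = n} :=
  have : Finite {a // Sum.elim f g (Sum.inl a) = n} := inferInstanceAs (Finite {a // f a = n})
  have : Finite {b // Sum.elim f g (Sum.inr b) = n} := inferInstanceAs (Finite {b // g b = n})
  Finite.of_equiv _ (Equiv.subtypeSum (p := fun c => Sum.elim f g c = n)).symm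

instance finite_prod_fiber (f : α → ℕ) (g : β → ℕ) [∀ n, Finite {a // f a = n}]
    [∀ n, Finite {b // g b = n}] (n : ℕ) : Finite {p : α × β // f p.1 + g p.2 = n} :=
  Finite.of_equiv _ (prodFiberEquiv f g n).symm

instance finite_add_one_fiber (f : α → ℕ) [∀ n, Finite {a // f a = n}] (n : ℕ) :
    Finite {a // f a + 1 = n} :=
  -- For `n = 0` the subtraction truncates, but the fiber is then empty.
  Finite.of_injective (β := {a // f a = n - 1})
    (fun a => ⟨a.1, by have := a.2; omega⟩) fun a b h => by
      simpa [Subtype.ext_iff] using h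

end weightSeries

/-! ### Functional equations for trees and marked trees -/

namespace MotzkinTree

/-- A tree is a leaf, a tree below a unary root, or two trees below a binary root. -/
def decompose : MotzkinTree ≃ Unit ⊕ MotzkinTree ⊕ MotzkinTree × MotzkinTree where
  toFun
    | leaf => .inl ()
    | unary t => .inr (.inl t)
    | binary l r => .inr (.inr (l, r))
  invFun
    | .inl _ => leaf
    | .inr (.inl t) => unary t
    | .inr (.inr p) => binary p.1 p.2
  left_inv t := by cases t <;> rfl
  right_inv c := by rcases c with _ | _ | _ <;> rfl

theorem weightSeries_size_eq :
    weightSeries size = X * (1 + (weightSeries size + weightSeries size * weightSeries size)) := by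
  have h : weightSeries size = weightSeries fun c : Unit ⊕ MotzkinTree ⊕ MotzkinTree × MotzkinTree =>
      Sum.elim (fun _ => 0) (Sum.elim size fun p => p.1.size + p.2.size) c + 1 :=
    weightSeries.congr decompose fun t => by cases t <;> rfl
  rw [← weightSeries.prod, ← weightSeries.sum]
  have h1 : (1 : ℚ⟦X⟧) = weightSeries fun _ : Unit => 0 := by simp [weightSeries.const]
  rw [h1, ← weightSeries.sum, ← weightSeries.add_one]
  exact h

/-- The marked trees for which the subtree of the marked vertex has a given property. -/
abbrev MarkedWith (Q : MotzkinTree → Prop) : Type := {p : Marked // Q p.vertex.subtree}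

/-- The weight of a marked tree is the size of the tree. -/
def markedSize (Q : MotzkinTree → Prop) (p : MarkedWith Q) : ℕ := p.1.tree.size

/-- In a marked tree either the root is marked, or one of the trees hanging from the root is. -/
def decomposeMarked (Q : MotzkinTree → Prop) :
    MarkedWith Q ≃ {t // Q t} ⊕ MarkedWith Q ⊕
      MarkedWith Q × MotzkinTree ⊕ MotzkinTree × MarkedWith Q where
  toFun
    | ⟨⟨t, .root _⟩, h⟩ => .inl ⟨t, h⟩
    | ⟨⟨unary t, .child v⟩, h⟩ => .inr (.inl ⟨⟨t, v⟩, h⟩)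
    | ⟨⟨binary l r, .left v⟩, h⟩ => .inr (.inr (.inl (⟨⟨l, v⟩, h⟩, r)))
    | ⟨⟨binary l r, .right v⟩, h⟩ => .inr (.inr (.inr (l, ⟨⟨r, v⟩, h⟩)))
  invFun
    | .inl t => ⟨⟨t.1, .root _⟩, t.2⟩
    | .inr (.inl p) => ⟨⟨unary p.1.tree, .child p.1.vertex⟩, p.2⟩
    | .inr (.inr (.inl (p, r))) => ⟨⟨binary p.1.tree r, .left p.1.vertex⟩, p.2⟩
    | .inr (.inr (.inr (l, p))) => ⟨⟨binary l p.1.tree, .right p.1.vertex⟩, p.2⟩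
  left_inv := by rintro ⟨⟨t, v⟩, h⟩; cases v <;> rfl
  right_inv c := by rcases c with _ | _ | _ | _ <;> rfl

instance finite_subtype_fiber (Q : MotzkinTree → Prop) (n : ℕ) :
    Finite {t : {t // Q t} // t.1.size = n} :=
  Finite.of_injective (β := {t : MotzkinTree // t.size = n})
    (fun t => ⟨t.1.1, t.2⟩) fun a b h => by simpa [Subtype.ext_iff] using h

instance finite_marked_fiber (Q : MotzkinTree → Prop) (n : ℕ) :
    Finite {p : MarkedWith Q // markedSize Q p = n} :=
  have := (finite_verticesOfSize n).to_subtype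
  Finite.of_injective (β := verticesOfSize n)
    (fun t => ⟨t.1.1, t.2⟩) fun a b h => by simpa [Subtype.ext_iff] using h

theorem weightSeries_marked_eq (Q : MotzkinTree → Prop) :
    weightSeries (markedSize Q) = weightSeries (fun t : {t // Q t} => t.1.size) +
      X * (weightSeries (markedSize Q) + (weightSeries (markedSize Q) * weightSeries size +
        weightSeries size * weightSeries (markedSize Q))) := by
  rw [← weightSeries.prod, ← weightSeries.prod, ← weightSeries.sum, ← weightSeries.sum,
    ← weightSeries.add_one, ← weightSeries.sum]
  refine weightSeries.congr (decomposeMarked Q) ?_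
  rintro ⟨⟨t, v⟩, h⟩
  cases v <;> rfl

/-- The square root of `1 - 2x - 3x²` with constant term `1`. -/
noncomputable def sqrtSeries : ℚ⟦X⟧ := 1 - X - 2 * X * weightSeries size

theorem constantCoeff_sqrtSeries : constantCoeff sqrtSeries = 1 := by simp [sqrtSeries]

theorem sqrtSeries_sq : sqrtSeries ^ 2 = 1 - 2 * (X : ℚ⟦X⟧) - 3 * (X : ℚ⟦X⟧) ^ 2 := by
  rw [sqrtSeries]
  linear_combination (-4 * (X : ℚ⟦X⟧)) * weightSeries_size_eq

theorem sqrtSeries_mul_inv : sqrtSeries * sqrtSeries⁻¹ = 1 :=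
  PowerSeries.mul_inv_cancel _ (by simp [constantCoeff_sqrtSeries])

/-- The decomposition of marked trees is linear in the marked series, with a coefficient
`sqrtSeries` that does not depend on `Q`. -/
theorem weightSeries_marked (Q : MotzkinTree → Prop) :
    weightSeries (markedSize Q) =
      weightSeries (fun t : {t // Q t} => t.1.size) * sqrtSeries⁻¹ := by
  have h : weightSeries (markedSize Q) * sqrtSeries =
      weightSeries (fun t : {t // Q t} => t.1.size) := by
    rw [sqrtSeries]
    linear_combination weightSeries_marked_eq Q
  rw [← h, mul_assoc, sqrtSeries_mul_inv, mul_one]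

theorem weightSeries_subtype_size_eq (k : ℕ) :
    weightSeries (fun t : {t : MotzkinTree // t.size = k} => t.1.size) =
      C (numTrees k : ℚ) * X ^ k := by
  rw [numTrees, ← weightSeries.const]
  exact congrArg _ (funext fun t => t.2)

theorem mk_numVertices (k : ℕ) : PowerSeries.mk (fun n => (numVertices n k : ℚ)) =
    C (numTrees k : ℚ) * X ^ k * sqrtSeries⁻¹ := by
  rw [← weightSeries_subtype_size_eq, ← weightSeries_marked]
  ext n
  simp only [weightSeries, coeff_mk]
  rw [numVertices, ← Nat.card_coe_set_eq]
  refine congrArg _ (Nat.card_congr ?_)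
  exact ((Equiv.subtypeSubtypeEquivSubtypeInter _ _).trans
    (Equiv.subtypeEquivRight fun p => and_comm)).symm

theorem mk_card_verticesOfSize : PowerSeries.mk (fun n => ((verticesOfSize n).ncard : ℚ)) =
    weightSeries size * sqrtSeries⁻¹ := by
  have h : weightSeries size = weightSeries fun t : {t : MotzkinTree // True} => t.1.size :=
    weightSeries.congr (Equiv.subtypeUnivEquiv fun _ => trivial).symm fun _ => rfl
  rw [h, ← weightSeries_marked]
  ext n
  simp only [weightSeries, coeff_mk]
  rw [← Nat.card_coe_set_eq]
  refine congrArg _ (Nat.card_congr ?_)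
  exact ((Equiv.subtypeSubtypeEquivSubtypeInter _ _).trans
    (Equiv.subtypeEquivRight fun p => iff_of_eq (true_and _))).symm

/-! ### Central trinomial coefficients and their recurrence -/

/-- The coefficients of `1 / √(1 - 2x - 3x²)`, the central trinomial coefficients. -/
noncomputable def centralTrinomial (n : ℕ) : ℚ := coeff n sqrtSeries⁻¹

theorem centralTrinomial_zero : centralTrinomial 0 = 1 := by
  simp [centralTrinomial, constantCoeff_sqrtSeries]

/-- Differentiating `s * s⁻¹ = 1` and `s² = 1 - 2X - 3X²` gives `s (s⁻¹)' = -s⁻¹ s'` and `s s' = -(1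
+ 3X)`; multiply the first by `s`. -/
theorem inv_sqrtSeries_ode :
    (1 - 2 * X - 3 * X ^ 2) * d⁄dX ℚ sqrtSeries⁻¹ = (1 + 3 * X) * sqrtSeries⁻¹ := by
  have h1 : sqrtSeries * d⁄dX ℚ sqrtSeries⁻¹ + sqrtSeries⁻¹ * d⁄dX ℚ sqrtSeries = 0 := by
    have := congrArg (d⁄dX ℚ) sqrtSeries_mul_inv
    simpa using this
  have h2 : 2 * (sqrtSeries * d⁄dX ℚ sqrtSeries) = 2 * (-(1 + 3 * X)) := by
    have := congrArg (d⁄dX ℚ) sqrtSeries_sq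
    have h3 : d⁄dX ℚ (3 : ℚ⟦X⟧) = 0 := by
      simpa using (d⁄dX ℚ).map_natCast 3
    have h4 : d⁄dX ℚ (2 : ℚ⟦X⟧) = 0 := by
      simpa using (d⁄dX ℚ).map_natCast 2
    simp only [pow_two, map_sub, Derivation.leibniz, smul_eq_mul, h3, h4, derivative_X, Derivation.map_one_eq_zero] at this
    linear_combination this
  have h2 := mul_left_cancel₀ (fun h => two_ne_zero (α := ℚ) (by
    rw [← map_ofNat (constantCoeff (R := ℚ)) 2, h, map_zero])) h2
  rw [← sqrtSeries_sq]
  linear_combination sqrtSeries * h1 - sqrtSeries⁻¹ * h2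

theorem centralTrinomial_one : centralTrinomial 1 = 1 := by
  have h := congrArg (coeff 0) inv_sqrtSeries_ode
  have e : (1 - 2 * X - 3 * X ^ 2) * d⁄dX ℚ sqrtSeries⁻¹ =
      d⁄dX ℚ sqrtSeries⁻¹ - X * ((2 + 3 * X) * d⁄dX ℚ sqrtSeries⁻¹) := by ring
  have e' : (1 + 3 * X) * sqrtSeries⁻¹ = sqrtSeries⁻¹ + X * (3 * sqrtSeries⁻¹) := by ring
  rw [e, e'] at h
  simp only [map_sub, map_add, coeff_zero_X_mul, coeff_derivative] at h
  have h0 := centralTrinomial_zero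
  simp only [centralTrinomial] at h0 ⊢
  rw [h0] at h
  simpa using h

theorem centralTrinomial_add_two (n : ℕ) :
    (n + 2) * centralTrinomial (n + 2) =
      (2 * n + 3) * centralTrinomial (n + 1) + 3 * (n + 1) * centralTrinomial n := by
  have h := congrArg (coeff (n + 1)) inv_sqrtSeries_ode
  have e : (1 - 2 * X - 3 * X ^ 2) * d⁄dX ℚ sqrtSeries⁻¹ =
    d⁄dX ℚ sqrtSeries⁻¹ - C 2 * (X * d⁄dX ℚ sqrtSeries⁻¹) -
      C 3 * (X * (X * d⁄dX ℚ sqrtSeries⁻¹)) := by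
    simp only [map_ofNat]; ring
  have e' : (1 + 3 * X) * sqrtSeries⁻¹ = sqrtSeries⁻¹ + C 3 * (X * sqrtSeries⁻¹) := by
    simp only [map_ofNat]; ring
  rw [e, e'] at h
  simp only [map_sub, map_add, coeff_C_mul, coeff_succ_X_mul, coeff_derivative] at h
  simp only [centralTrinomial]
  -- The doubly shifted term contributes to the coefficient of degree `n + 1` only when `n ≥ 1`.
  cases n with
  | zero =>
    simp at h ⊢
    linarith
  | succ n =>
    simp only [coeff_succ_X_mul, coeff_derivative] at h
    push_cast at h ⊢
    linarith

theorem numVertices_add (n k : ℕ) :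
    (numVertices (n + k) k : ℚ) = numTrees k * centralTrinomial n := by
  have h := congrArg (coeff (n + k)) (mk_numVertices k)
  rwa [mul_assoc, coeff_mk, coeff_C_mul, coeff_X_pow_mul] at h

/-- This is `2XM = 1 - X - s` divided by `s`. -/
theorem two_mul_ncard_verticesOfSize (n : ℕ) :
    2 * ((verticesOfSize n).ncard : ℚ) = centralTrinomial (n + 1) - centralTrinomial n := by
  have h : C 2 * (X * PowerSeries.mk fun n => ((verticesOfSize n).ncard : ℚ)) =
      sqrtSeries⁻¹ - X * sqrtSeries⁻¹ - 1 := by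
    rw [mk_card_verticesOfSize, ← sqrtSeries_mul_inv, map_ofNat]
    -- The fourth occurrence is the only one not inverted; unfolding it leaves an identity linear in
    -- `sqrtSeries⁻¹`.
    nth_rw 4 [sqrtSeries]
    ring
  have h := congrArg (coeff (n + 1)) h
  simpa [coeff_succ_X_mul, coeff_C_mul, coeff_one, centralTrinomial] using h

end MotzkinTree

/-! ### Convergence of the ratios of consecutive coefficients -/

section RatioRecurrence

variable {r : ℕ → ℝ}

/-- Each bound feeds the other, since the recurrence is decreasing in `r n`. The lower bound makes
the error recursion a contraction. -/
theorem ratio_bounds (h0 : r 0 = 1)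
    (hr : ∀ n : ℕ, r (n + 1) = ((2 * n + 3) + 3 * (n + 1) / r n) / (n + 2)) (n : ℕ) :
    3 / 2 ≤ r (n + 1) ∧ r (n + 1) ≤ 4 := by
  induction n with
  | zero => rw [hr, h0]; norm_num
  | succ n ih =>
    obtain ⟨h1, h2⟩ := ih
    have hpos : 0 < r (n + 1) := by linarith
    have hn : (0 : ℝ) ≤ n := n.cast_nonneg
    rw [hr (n + 1)]
    push_cast
    have h3 : 3 / r (n + 1) ≤ 2 := by rw [div_le_iff₀ hpos]; linarith
    have h4 : 3 / 4 ≤ 3 / r (n + 1) := by gcongr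
    rw [mul_div_right_comm, le_div_iff₀ (by positivity), div_le_iff₀ (by positivity)]
    constructor <;> nlinarith

/-- The constant `6` reproduces itself: dividing by `r ≥ 3/2` turns it into `4`, and the
inhomogeneous term adds `2`. -/
theorem abs_ratio_sub_three_le (h0 : r 0 = 1)
    (hr : ∀ n : ℕ, r (n + 1) = ((2 * n + 3) + 3 * (n + 1) / r n) / (n + 2)) (n : ℕ) :
    |r (n + 1) - 3| ≤ 6 / (n + 2) := by
  induction n with
  | zero => rw [hr, h0]; norm_num
  | succ n ih =>
    have h1 := (ratio_bounds h0 hr n).1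
    have hpos : 0 < r (n + 1) := by linarith
    have hn : (0 : ℝ) ≤ n := n.cast_nonneg
    have e : r (n + 2) - 3 = ((n + 2) * ((3 - r (n + 1)) / r (n + 1)) - 2) / (n + 3) := by
      rw [hr (n + 1)]
      push_cast
      field_simp
      ring
    have h2 : |(3 - r (n + 1)) / r (n + 1)| ≤ 4 / (n + 2) := by
      rw [abs_div, abs_sub_comm, abs_of_pos hpos, div_le_iff₀ hpos]
      refine ih.trans ?_
      calc (6 : ℝ) / (n + 2) = 4 / (n + 2) * (3 / 2) := by ring
        _ ≤ _ := by gcongr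
    rw [show n + 1 + 1 = n + 2 from rfl, e, abs_div, abs_of_pos (by positivity : (0 : ℝ) < n + 3)]
    push_cast
    rw [show (n : ℝ) + 1 + 2 = n + 3 by ring]
    gcongr
    refine (abs_sub _ _).trans ?_
    rw [abs_mul, abs_of_pos (by positivity : (0 : ℝ) < n + 2), abs_two]
    have h3 : ((n : ℝ) + 2) * |(3 - r (n + 1)) / r (n + 1)| ≤ (n + 2) * (4 / (n + 2)) := by gcongr
    rw [mul_div_cancel₀ _ (by positivity)] at h3
    linarith

theorem tendsto_ratio (h0 : r 0 = 1)
    (hr : ∀ n : ℕ, r (n + 1) = ((2 * n + 3) + 3 * (n + 1) / r n) / (n + 2)) :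
    Tendsto r atTop (𝓝 3) := by
  rw [← tendsto_add_atTop_iff_nat 1, tendsto_iff_norm_sub_tendsto_zero]
  refine squeeze_zero (fun _ => norm_nonneg _) (abs_ratio_sub_three_le h0 hr) ?_
  have := (tendsto_natCast_atTop_atTop (R := ℝ)).atTop_add (tendsto_const_nhds (x := (2 : ℝ)))
  exact this.const_div_atTop 6

end RatioRecurrence

/-- The quotient telescopes into `k` inverse ratios, each tending to `c⁻¹`. -/
theorem tendsto_div_of_tendsto_ratio {T : ℕ → ℝ} (hT : ∀ n, T n ≠ 0) {c : ℝ} (hc : c ≠ 0)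
    (h : Tendsto (fun n => T (n + 1) / T n) atTop (𝓝 c)) (k : ℕ) :
    Tendsto (fun n => T n / T (n + k)) atTop (𝓝 (c⁻¹ ^ k)) := by
  induction k with
  | zero => simp [hT]
  | succ k ih =>
    rw [pow_succ]
    refine (ih.mul (((tendsto_add_atTop_iff_nat k).2 h).inv₀ hc)).congr fun n => ?_
    rw [inv_div, div_mul_div_cancel₀ (hT _)]
    rfl

/-! ### The limiting probabilities -/

namespace MotzkinTree

theorem centralTrinomial_pos (n : ℕ) : 0 < centralTrinomial n := by
  suffices h : 0 < centralTrinomial n ∧ 0 < centralTrinomial (n + 1) from h.1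
  induction n with
  | zero => simp [centralTrinomial_zero, centralTrinomial_one]
  | succ n ih =>
    obtain ⟨h1, h2⟩ := ih
    refine ⟨h2, pos_of_mul_pos_right (a := (n + 2 : ℚ)) ?_ (by positivity)⟩
    rw [centralTrinomial_add_two]
    positivity

theorem tendsto_centralTrinomial_ratio :
    Tendsto (fun n => (centralTrinomial (n + 1) : ℝ) / centralTrinomial n) atTop (𝓝 3) := by
  refine tendsto_ratio (by simp [centralTrinomial_zero, centralTrinomial_one]) fun n => ?_
  have h : ((n : ℝ) + 2) * centralTrinomial (n + 2) =
      (2 * n + 3) * centralTrinomial (n + 1) + 3 * (n + 1) * centralTrinomial n := by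
    exact_mod_cast centralTrinomial_add_two n
  have h0 : (0 : ℝ) < centralTrinomial n := by exact_mod_cast centralTrinomial_pos n
  have h1 : (0 : ℝ) < centralTrinomial (n + 1) := by exact_mod_cast centralTrinomial_pos (n + 1)
  rw [show n + 1 + 1 = n + 2 from rfl]
  field_simp
  linarith

instance : MeasurableSingletonClass Marked := ⟨fun _ => trivial⟩

theorem subtreeSizeLaw_apply (n : ℕ) (s : Set ℕ) :
    subtreeSizeLaw n s = (Measure.count (verticesOfSize n))⁻¹ *
      Measure.count {p ∈ verticesOfSize n | p.vertex.subtree.size ∈ s} := by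
  have hm : Measurable fun p : Marked => p.vertex.subtree.size := fun _ _ => trivial
  rw [subtreeSizeLaw, Measure.map_apply hm trivial, ProbabilityTheory.uniformOn,
    ProbabilityTheory.cond_apply (finite_verticesOfSize n).measurableSet]
  rfl

theorem subtreeSizeLaw_real_singleton (n k : ℕ) :
    (subtreeSizeLaw n).real {k} = numVertices n k / (verticesOfSize n).ncard := by
  have h : ∀ s : Set Marked, s.Finite → (Measure.count s).toReal = s.ncard := fun s hs => by
    rw [Measure.count_apply_finite s hs, Set.ncard_eq_toFinset_card s hs]
    simp
  rw [Measure.real, subtreeSizeLaw_apply, ENNReal.toReal_mul, ENNReal.toReal_inv,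
    h _ (finite_verticesOfSize n), h _ ((finite_verticesOfSize n).subset (Set.sep_subset _ _)),
    numVertices, div_eq_inv_mul]
  rfl

theorem tendsto_subtreeSizeLaw (k : ℕ) :
    Tendsto (fun n => (subtreeSizeLaw n).real {k}) atTop
      (𝓝 ((numTrees k : ℝ) * (1 / 3) ^ k)) := by
  rw [← tendsto_add_atTop_iff_nat k]
  have hT : ∀ n, (centralTrinomial n : ℝ) ≠ 0 := fun n => by
    exact_mod_cast (centralTrinomial_pos n).ne'
  have h1 := tendsto_div_of_tendsto_ratio hT three_ne_zero tendsto_centralTrinomial_ratio k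
  -- Numerator and denominator of the probability are both divided by `T (n + k)`; this denominator
  -- tends to `3 - 1 = 2`.
  have h2 := ((tendsto_add_atTop_iff_nat k).2 tendsto_centralTrinomial_ratio).sub_const 1
  have h3 := ((h1.div h2 (by norm_num)).const_mul (2 * (numTrees k : ℝ)))
  convert h3 using 2 with n
  · rw [subtreeSizeLaw_real_singleton]
    have e1 : (numVertices (n + k) k : ℝ) = numTrees k * centralTrinomial n := by
      exact_mod_cast numVertices_add n k
    have e2 : 2 * ((verticesOfSize (n + k)).ncard : ℝ) =
        centralTrinomial (n + k + 1) - centralTrinomial (n + k) := by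
      exact_mod_cast two_mul_ncard_verticesOfSize (n + k)
    have e3 : ((verticesOfSize (n + k)).ncard : ℝ) =
        (centralTrinomial (n + k + 1) - centralTrinomial (n + k)) / 2 := by linarith
    simp only [Pi.div_apply]
    rw [e1, e3, div_sub_one (hT _), div_div_div_cancel_right₀ (hT _)]
    rw [div_div_eq_mul_div]
    ring
  · rw [one_div]; ring

/-! ### Total mass one and tightness -/

theorem sum_numTrees_le_one (s : Finset ℕ) :
    ∑ k ∈ s, (numTrees k : ℝ) * (1 / 3) ^ k ≤ 1 := by
  refine le_of_tendsto' (f := fun n => ∑ k ∈ s, (subtreeSizeLaw (n + 1)).real {k})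
    (tendsto_finsetSum s fun k _ => (tendsto_add_atTop_iff_nat 1).2 (tendsto_subtreeSizeLaw k))
    fun n => ?_
  rw [sum_measureReal_singleton]
  exact measureReal_le_one

theorem numTrees_zero : numTrees 0 = 0 := by
  have : IsEmpty {t : MotzkinTree // t.size = 0} := ⟨fun t => t.1.size_pos.ne' t.2⟩
  simp [numTrees]

theorem numTrees_succ (n : ℕ) : (numTrees (n + 1) : ℝ) = (if n = 0 then 1 else 0) + (numTrees n +
    ∑ q ∈ Finset.HasAntidiagonal.antidiagonal n, (numTrees q.1 : ℝ) * numTrees q.2) := by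
  have h := congrArg (coeff (n + 1)) weightSeries_size_eq
  rw [coeff_succ_X_mul, map_add, map_add, coeff_mul, coeff_one] at h
  simp only [weightSeries, coeff_mk] at h
  exact_mod_cast h

/-- Bounded partial sums give summability, so the equation of `M` may be evaluated at `1/3`. There
its discriminant vanishes, and the double root `1` fixes the sum with no choice of branch. -/
theorem hasSum_numTrees : HasSum (fun k => (numTrees k : ℝ) * (1 / 3) ^ k) 1 := by
  set f : ℕ → ℝ := fun k => (numTrees k : ℝ) * (1 / 3) ^ k with hf
  have hf0 : ∀ k, 0 ≤ f k := fun k => by positivity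
  have hs : Summable f := summable_of_sum_le hf0 sum_numTrees_le_one
  have hn : Summable fun k => ‖f k‖ := hs.norm
  have hprod := tsum_mul_tsum_eq_tsum_sum_antidiagonal_of_summable_norm hn hn
  have hsprod := (summable_norm_sum_mul_antidiagonal_of_summable_norm hn hn).of_norm
  have hsucc : ∀ n, f (n + 1) = (1 / 3) * ((if n = 0 then 1 else 0) + (f n +
      ∑ q ∈ Finset.HasAntidiagonal.antidiagonal n, f q.1 * f q.2)) := fun n => by
    have : ∑ q ∈ Finset.HasAntidiagonal.antidiagonal n, f q.1 * f q.2 =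
        (∑ q ∈ Finset.HasAntidiagonal.antidiagonal n, (numTrees q.1 : ℝ) * numTrees q.2) *
          (1 / 3) ^ n := by
      rw [Finset.sum_mul]
      refine Finset.sum_congr rfl fun q hq => ?_
      rw [← Finset.HasAntidiagonal.mem_antidiagonal.1 hq, hf]
      ring
    rw [this]
    simp only [hf]
    rw [numTrees_succ, pow_succ]
    split_ifs with h
    · subst h; ring
    · ring
  have hone : HasSum (fun n : ℕ => if n = 0 then (1 : ℝ) else 0) 1 := hasSum_ite_eq 0 1
  have hy : ∑' k, f k = (1 / 3) * (1 + (∑' k, f k + (∑' k, f k) * ∑' k, f k)) := by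
    rw [hprod]
    have h := (hone.add (hs.hasSum.add hsprod.hasSum)).mul_left (1 / 3)
    have h' := (hasSum_nat_add_iff' 1).2 hs.hasSum
    rw [Finset.sum_range_one, show f 0 = 0 by simp [hf, numTrees_zero], sub_zero,
      funext hsucc] at h'
    exact h'.unique h
  have : ∑' k, f k = 1 := by
    have : (∑' k, f k - 1) ^ 2 = 0 := by linarith
    linarith [pow_eq_zero_iff (two_ne_zero) |>.1 this]
  exact this ▸ hs.hasSum

theorem size_subtree_le {t : MotzkinTree} (v : Vertex t) : v.subtree.size ≤ t.size := by
  induction v <;> simp only [Vertex.subtree, size] <;> omega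

theorem isTightMeasureSet_subtreeSizeLaw :
    IsTightMeasureSet (Set.range fun n => subtreeSizeLaw (n + 1)) := by
  rw [isTightMeasureSet_iff_exists_isCompact_measure_compl_le]
  intro ε hε
  obtain ⟨δ, -, hδε⟩ := ENNReal.lt_iff_exists_real_btwn.1 hε
  have hδ0 : 0 < δ := ENNReal.ofReal_pos.1 hδε.1
  obtain ⟨K, hK⟩ := (hasSum_numTrees.tendsto_sum_nat.eventually
    (lt_mem_nhds (show 1 - δ < 1 by linarith))).exists
  have hlim := tendsto_finsetSum (Finset.range K) fun k _ =>
    (tendsto_add_atTop_iff_nat 1).2 (tendsto_subtreeSizeLaw k)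
  obtain ⟨N, hN⟩ := eventually_atTop.1 (hlim.eventually (lt_mem_nhds hK))
  -- `range K` carries mass above `1 - δ` for every `n ≥ N`; for `n ≤ N` subtree sizes are at most
  -- `n + 1 < N + 2`, so `range (N + 2)` carries everything.
  refine ⟨↑(Finset.range K ∪ Finset.range (N + 2)), (Finset.finite_toSet _).isCompact, ?_⟩
  rintro _ ⟨n, rfl⟩
  dsimp only
  rcases le_total N n with hn | hn
  · refine le_trans (measure_mono (t := (↑(Finset.range K))ᶜ) ?_) (le_trans ?_ hδε.2.le)
    · exact Set.compl_subset_compl.2 (Finset.coe_subset.2 Finset.subset_union_left)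
    · have h := hN n hn
      rw [sum_measureReal_singleton] at h
      rw [ENNReal.le_ofReal_iff_toReal_le (measure_ne_top _ _) hδ0.le]
      have h' := probReal_compl_eq_one_sub (μ := subtreeSizeLaw (n + 1))
        (Finset.measurableSet (Finset.range K))
      rw [Measure.real] at h'
      rw [h']
      linarith
  · refine le_trans (le_of_eq ?_) hε.le
    rw [subtreeSizeLaw_apply]
    convert mul_zero _
    rw [Measure.count_eq_zero_iff, Set.eq_empty_iff_forall_notMem]
    rintro ⟨t, v⟩ ⟨ht, hv⟩
    have h1 : t.size = n + 1 := ht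
    have h2 := size_subtree_le v
    refine hv (Finset.mem_coe.2 (Finset.mem_union_right _ (Finset.mem_range.2 ?_)))
    dsimp only
    omega

end MotzkinTree

theorem mainTheorem9 :
    -- the generating function is `M_k x^k / √(1 - 2x - 3x²)`
    (∃ s : ℚ⟦X⟧, PowerSeries.constantCoeff s = 1 ∧
      s ^ 2 = 1 - 2 * (PowerSeries.X : ℚ⟦X⟧) - 3 * (PowerSeries.X : ℚ⟦X⟧) ^ 2 ∧
      ∀ k : ℕ, PowerSeries.mk (fun n => (MotzkinTree.numVertices n k : ℚ)) =
        PowerSeries.C (MotzkinTree.numTrees k : ℚ) * (PowerSeries.X : ℚ⟦X⟧) ^ k * s⁻¹) ∧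
    -- the limiting probabilities
    (∀ k : ℕ, Tendsto (fun n => (MotzkinTree.subtreeSizeLaw n).real {k}) atTop
      (𝓝 ((MotzkinTree.numTrees k : ℝ) * (1 / 3) ^ k))) ∧
    -- they sum to one
    HasSum (fun k => (MotzkinTree.numTrees k : ℝ) * (1 / 3) ^ k) 1 ∧
    -- tightness
    IsTightMeasureSet (Set.range fun n => MotzkinTree.subtreeSizeLaw (n + 1)) :=
  ⟨⟨MotzkinTree.sqrtSeries, MotzkinTree.constantCoeff_sqrtSeries, MotzkinTree.sqrtSeries_sq,
    MotzkinTree.mk_numVertices⟩, MotzkinTree.tendsto_subtreeSizeLaw, MotzkinTree.hasSum_numTrees,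
    MotzkinTree.isTightMeasureSet_subtreeSizeLaw⟩
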